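/- Let $A\in\mathbb C^{3\times 3}$ be a matrix whose determinant is a positive real number, and let $W(A)=\{x^*Ax : x\in\mathbb C^3,\ x^*x=1\}$ be its numerical range. Then $W(A)$ is invariant under the rotation of angle $2\pi/3$ centered at $0$, i.e. $e^{2\pi i/3}\,W(A)=W(A)$, if and only if there exist real numbers $\alpha_1>0$, $\alpha_2>0$, $\alpha_3>0$ and $\theta\in\mathbb R$ such that $A$ is unitarily similar to $$e^{i\theta}\begin{pmatrix}0&\alpha_1&0\\0&0&\alpha_2\\\alpha_3&0&0\end{pmatrix},$$ i.e. such that $A=U\,e^{i\theta}\begin{pmatrix}0&\alpha_1&0\\0&0&\alpha_2\\\alpha_3&0&0\end{pmatrix}U^*$ for some unitary matrix $U\in\mathbb C^{3\times 3}$. -/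

import Mathlib

open scoped Matrix

noncomputable section

/-- The numerical range (field of values) `{x* A x : x* x = 1}` of a complex square matrix. -/
def numericalRange {n : Type*} [Fintype n] (A : Matrix n n ℂ) : Set ℂ :=
  {z : ℂ | ∃ x : n → ℂ, star x ⬝ᵥ x = 1 ∧ z = star x ⬝ᵥ (A *ᵥ x)}

/-- `S` is invariant under the rotation of angle `φ` centered at `0`: the image of `S` under
this rotation is `S`. -/
def IsRotationInvariant (φ : ℝ) (S : Set ℂ) : Prop :=
  (fun z : ℂ => Complex.exp (φ * Complex.I) * z) '' S = S

/-- `A` and `B` are unitarily similar: `A = U B U*` for some unitary matrix `U`. -/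
def UnitarilySimilar {n : Type*} [Fintype n] [DecidableEq n] (A B : Matrix n n ℂ) : Prop :=
  ∃ U ∈ Matrix.unitaryGroup n ℂ, A = U * B * Uᴴ

/-- The weighted cyclic permutation matrix of order three with weights `α₁`, `α₂`, `α₃`. -/
def weightedCyclic (α₁ α₂ α₃ : ℝ) : Matrix (Fin 3) (Fin 3) ℂ :=
  !![0, (α₁ : ℂ), 0;
     0, 0, (α₂ : ℂ);
     (α₃ : ℂ), 0, 0]

end

/-! The support function `h θ` of `W(A)` is the largest eigenvalue of the Hermitian part of `e^{-iθ}
A`, and invariance makes it a common eigenvalue for three directions. Separating the three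
characteristic equations by powers of `ω` forces `tr A = tr (adj A) = tr (adj A * Aᴴ) = 0`
(`det_trace_conditions`). Hence `adj A = A²`, `A³ = d`, `tr A² = tr (A² Aᴴ) = 0`.

These traces yield an eigenvector `v` of `Aᴴ A` with `v* A v = 0` (`exists_eigenvector_isotropic`).
Then `v, A v, A² v` are orthogonal and `A` permutes their lines cyclically, so normalizing them
gives the weighted cyclic form. Conversely, a diagonal unitary conjugates that form to `ω` times
itself. -/

/-! ### Quadratic forms, unitary invariance and the converse direction. -/

theorem Matrix.IsHermitian.exists_eq_unitary_mul_diagonal {n : Type*} [Fintype n] [DecidableEq n]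
    {H : Matrix n n ℂ} (hH : H.IsHermitian) :
    ∃ U ∈ Matrix.unitaryGroup n ℂ, ∃ s : n → ℝ,
      H = U * Matrix.diagonal (fun i => (s i : ℂ)) * Uᴴ := by
  refine ⟨hH.eigenvectorUnitary, hH.eigenvectorUnitary.2, hH.eigenvalues, ?_⟩
  have h := hH.spectral_theorem
  rw [Unitary.conjStarAlgAut_apply] at h
  exact h

theorem star_dotProduct_mulVec_unitary {n : Type*} [Fintype n] [DecidableEq n]
    {U : Matrix n n ℂ} (hU : Uᴴ * U = 1) (x y : n → ℂ) :
    star (U *ᵥ x) ⬝ᵥ (U *ᵥ y) = star x ⬝ᵥ y := by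
  rw [Matrix.star_mulVec, ← Matrix.dotProduct_mulVec, Matrix.mulVec_mulVec, hU, Matrix.one_mulVec]

open scoped ComplexOrder in
/-- The largest eigenvalue of a Hermitian matrix is the maximum of its quadratic form on the
unit sphere. -/
theorem Matrix.IsHermitian.exists_isGreatest {n : Type*} [Fintype n] [DecidableEq n] [Nonempty n]
    {H : Matrix n n ℂ} (hH : H.IsHermitian) :
    ∃ μ : ℝ, IsGreatest {r : ℝ | ∃ x : n → ℂ, star x ⬝ᵥ x = 1 ∧ r = (star x ⬝ᵥ (H *ᵥ x)).re} μ ∧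
      ((μ : ℂ) • (1 : Matrix n n ℂ) - H).det = 0 := by
  obtain ⟨U, hU, s, hs⟩ := hH.exists_eq_unitary_mul_diagonal
  obtain ⟨i, -, hi⟩ := Finset.exists_max_image Finset.univ s Finset.univ_nonempty
  have hU1 : Uᴴ * U = 1 := Matrix.mem_unitaryGroup_iff'.1 hU
  have hU2 : U * Uᴴ = 1 := Matrix.mem_unitaryGroup_iff.1 hU
  have hdiff : ((s i : ℂ) • (1 : Matrix n n ℂ) - H)
      = U * Matrix.diagonal (fun j => ((s i : ℂ) - s j)) * Uᴴ := by
    have h1 : Matrix.diagonal (fun j => ((s i : ℂ) - s j))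
        = (s i : ℂ) • (1 : Matrix n n ℂ) - Matrix.diagonal (fun j => (s j : ℂ)) := by
      rw [Matrix.smul_one_eq_diagonal, Matrix.diagonal_sub]
    rw [h1, mul_sub, sub_mul, ← hs, Matrix.mul_smul, Matrix.smul_mul, mul_one, hU2]
  refine ⟨s i, ⟨⟨U *ᵥ Pi.single i 1, ?_, ?_⟩, ?_⟩, ?_⟩
  · rw [star_dotProduct_mulVec_unitary hU1]
    simp
  · have h2 : H *ᵥ (U *ᵥ Pi.single i 1) = U *ᵥ ((s i : ℂ) • Pi.single i 1) := by
      conv_lhs => rw [hs]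
      rw [Matrix.mulVec_mulVec, mul_assoc, hU1, mul_one, ← Matrix.mulVec_mulVec,
        Matrix.diagonal_mulVec_single]
      congr 1
      ext j
      simp [Pi.single_apply]
    rw [h2, star_dotProduct_mulVec_unitary hU1]
    simp
  · rintro r ⟨x, hx, rfl⟩
    have hpos : ((s i : ℂ) • (1 : Matrix n n ℂ) - H).PosSemidef := by
      rw [hdiff]
      refine Matrix.PosSemidef.mul_mul_conjTranspose_same (Matrix.PosSemidef.diagonal ?_) _
      intro j
      have := hi j (Finset.mem_univ _)
      show (0 : ℂ) ≤ (s i : ℂ) - s j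
      rw [← Complex.ofReal_sub]
      exact_mod_cast sub_nonneg.2 this
    have h3 := hpos.re_dotProduct_nonneg x
    rw [Matrix.sub_mulVec, Matrix.smul_mulVec, Matrix.one_mulVec, dotProduct_sub, dotProduct_smul,
      hx] at h3
    simpa using h3
  · rw [hdiff, Matrix.det_mul, Matrix.det_mul, Matrix.det_diagonal,
      Finset.prod_eq_zero (Finset.mem_univ i) (sub_self _)]
    simp

/-- The numerical range is a unitary invariant. -/
theorem UnitarilySimilar.numericalRange_eq {n : Type*} [Fintype n] [DecidableEq n]
    {A B : Matrix n n ℂ} (h : UnitarilySimilar A B) : numericalRange A = numericalRange B := by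
  obtain ⟨U, hU, rfl⟩ := h
  have hU1 : Uᴴ * U = 1 := Matrix.mem_unitaryGroup_iff'.1 hU
  have hU2 : U * Uᴴ = 1 := Matrix.mem_unitaryGroup_iff.1 hU
  have hU3 : Uᴴᴴ * Uᴴ = 1 := by rw [Matrix.conjTranspose_conjTranspose, hU2]
  ext z
  constructor
  · rintro ⟨x, hx, rfl⟩
    refine ⟨Uᴴ *ᵥ x, by rw [star_dotProduct_mulVec_unitary hU3, hx], ?_⟩
    rw [mul_assoc, ← Matrix.mulVec_mulVec, ← Matrix.mulVec_mulVec, Matrix.star_mulVec,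
      Matrix.conjTranspose_conjTranspose, ← Matrix.dotProduct_mulVec, Matrix.mulVec_mulVec]
  · rintro ⟨x, hx, rfl⟩
    refine ⟨U *ᵥ x, by rw [star_dotProduct_mulVec_unitary hU1, hx], ?_⟩
    rw [Matrix.mulVec_mulVec, mul_assoc, hU1, mul_one, ← Matrix.mulVec_mulVec,
      star_dotProduct_mulVec_unitary hU1]

theorem numericalRange_smul {n : Type*} [Fintype n] (c : ℂ) (A : Matrix n n ℂ) :
    numericalRange (c • A) = (fun z => c * z) '' numericalRange A := by
  ext z
  constructor
  · rintro ⟨x, hx, rfl⟩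
    exact ⟨_, ⟨x, hx, rfl⟩, by simp [Matrix.smul_mulVec]⟩
  · rintro ⟨_, ⟨x, hx, rfl⟩, rfl⟩
    exact ⟨x, hx, by simp [Matrix.smul_mulVec]⟩

theorem unitarilySimilar_smul_weightedCyclic (c ζ : ℂ) (hζ : ζ ^ 3 = 1) (hζ1 : star ζ * ζ = 1)
    (α₁ α₂ α₃ : ℝ) :
    UnitarilySimilar (ζ • (c • weightedCyclic α₁ α₂ α₃)) (c • weightedCyclic α₁ α₂ α₃) := by
  have h2 : (starRingEnd ℂ) ζ * ζ = 1 := hζ1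
  have hc : (starRingEnd ℂ) ζ = ζ ^ 2 := by
    calc (starRingEnd ℂ) ζ = (starRingEnd ℂ) ζ * ζ ^ 3 := by rw [hζ, mul_one]
      _ = ((starRingEnd ℂ) ζ * ζ) * ζ ^ 2 := by ring
      _ = ζ ^ 2 := by rw [h2, one_mul]
  have h4 : ζ ^ 4 = ζ := by rw [pow_succ, hζ, one_mul]
  refine ⟨Matrix.diagonal ![1, ζ ^ 2, ζ], ?_, ?_⟩
  · rw [Matrix.mem_unitaryGroup_iff', Matrix.star_eq_conjTranspose, Matrix.diagonal_conjTranspose,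
      Matrix.diagonal_mul_diagonal, ← Matrix.diagonal_one]
    congr 1
    ext i
    fin_cases i <;> simp [hc]
    · linear_combination (ζ ^ 3 + 1) * hζ
    · linear_combination hζ
  · rw [Matrix.diagonal_conjTranspose]
    ext i j
    rw [Matrix.mul_diagonal, Matrix.diagonal_mul]
    fin_cases i <;> fin_cases j <;> simp [weightedCyclic, hc]
    all_goals ring_nf
    all_goals try simp only [h4]

/-! ### Trace conditions from the characteristic polynomial of the pencil. -/

/-- The characteristic polynomial of the pencil `s A + t B` of matrices of order three. -/
theorem det_smul_one_sub_pencil (A B : Matrix (Fin 3) (Fin 3) ℂ) (z s t : ℂ) :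
    (z • (1 : Matrix (Fin 3) (Fin 3) ℂ) - (s • A + t • B)).det =
      z ^ 3 - z ^ 2 * (s * A.trace + t * B.trace)
        + z * (s ^ 2 * A.adjugate.trace + s * t * (A.trace * B.trace - (A * B).trace)
          + t ^ 2 * B.adjugate.trace)
        - (s ^ 3 * A.det + s ^ 2 * t * (A.adjugate * B).trace
          + s * t ^ 2 * (B.adjugate * A).trace + t ^ 3 * B.det) := by
  rw [Matrix.adjugate_fin_three, Matrix.adjugate_fin_three, Matrix.det_fin_three,
    Matrix.det_fin_three, Matrix.det_fin_three]
  simp [Matrix.trace, Fin.sum_univ_three, Matrix.mul_apply, Matrix.vecMul, dotProduct]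
  ring

/-- Cayley–Hamilton in a form valid also for singular `A`; once both traces vanish it leaves `adj A
= A²`. -/
theorem adjugate_eq_of_fin_three (A : Matrix (Fin 3) (Fin 3) ℂ) :
    A.adjugate = A ^ 2 - A.trace • A + A.adjugate.trace • (1 : Matrix (Fin 3) (Fin 3) ℂ) := by
  rw [Matrix.adjugate_fin_three]
  ext i j
  fin_cases i <;> fin_cases j <;>
    simp [Matrix.trace, Fin.sum_univ_three, Matrix.mul_apply, pow_two] <;> ring

/-- Taking squared moduli in `a x² + c = -b u x` removes the unknown phase `u`, leaving a real
polynomial in `x` with infinitely many roots. Its extreme coefficients are `|a|²` and `|c|²`; with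
these zero the middle one is `-|b|²`. -/
theorem coeff_eq_zero_of_infinite {a b c : ℂ} {S : Set ℝ} (hS : S.Infinite)
    (h : ∀ x ∈ S, ∃ u : ℂ, ‖u‖ = 1 ∧ a * (x : ℂ) ^ 2 + b * u * x + c = 0) :
    a = 0 ∧ b = 0 ∧ c = 0 := by
  open Polynomial in
  have hp : (C (Complex.normSq a) * X ^ 4
      + C (2 * (a * (starRingEnd ℂ) c).re - Complex.normSq b) * X ^ 2
      + C (Complex.normSq c) : ℝ[X]) = 0 := by
    refine Polynomial.eq_zero_of_infinite_isRoot _ (hS.mono ?_)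
    intro x hx
    obtain ⟨u, hu, h0⟩ := h x hx
    have h1 : a * (x : ℂ) ^ 2 + c = - (b * u * x) := by linear_combination h0
    have h2 := congrArg Complex.normSq h1
    rw [Complex.normSq_add, Complex.normSq_neg, Complex.normSq_mul, Complex.normSq_mul,
      Complex.normSq_mul, ← Complex.ofReal_pow, Complex.normSq_ofReal, Complex.normSq_ofReal,
      Complex.normSq_eq_norm_sq u, hu] at h2
    have h3 : (a * ((x ^ 2 : ℝ) : ℂ) * (starRingEnd ℂ) c).re
        = x ^ 2 * (a * (starRingEnd ℂ) c).re := by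
      rw [mul_right_comm, mul_comm, Complex.re_ofReal_mul]
    rw [h3] at h2
    simp only [Set.mem_ofPred_eq, IsRoot.def, eval_add, eval_mul, eval_C, eval_pow, eval_X]
    linear_combination h2
  generalize hq : 2 * (a * (starRingEnd ℂ) c).re - Complex.normSq b = q at hp
  have h4 := congrArg (fun p => Polynomial.coeff p 4) hp
  have h2 := congrArg (fun p => Polynomial.coeff p 2) hp
  have h0 := congrArg (fun p => Polynomial.coeff p 0) hp
  simp [Polynomial.coeff_C, Polynomial.coeff_X_pow] at h4 h2 h0
  subst h4 h0 h2
  simpa using hq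

/-- If the Hermitian parts of `A` in the directions `θ`, `θ + 2π/3`, `θ + 4π/3` have a common
eigenvalue for every `θ`, then the coefficients of the characteristic polynomial of the pencil that
are not invariant under the rotation vanish. -/
theorem det_trace_conditions (A : Matrix (Fin 3) (Fin 3) ℂ) (d : ℝ) (hd : d ≠ 0)
    (hdet : A.det = d) (ω : ℂ) (hω : 1 + ω + ω ^ 2 = 0)
    (h : ℝ → ℝ)
    (hh : ∀ θ : ℝ, ∀ k : ℕ, ((h θ : ℂ) • (1 : Matrix (Fin 3) (Fin 3) ℂ)
      - (((ω ^ (2 * k) * Complex.exp (-θ * Complex.I) / 2) • A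
        + (ω ^ k * Complex.exp (θ * Complex.I) / 2) • Aᴴ))).det = 0) :
    A.trace = 0 ∧ A.adjugate.trace = 0 ∧ (A.adjugate * Aᴴ).trace = 0 := by
  have hω3 : ω ^ 3 = 1 := by linear_combination (ω - 1) * hω
  have hBd : (Aᴴ).det = d := by rw [Matrix.det_conjTranspose, hdet]; simp
  set F := A.trace * (Aᴴ).trace - (A * Aᴴ).trace with hF
  -- Sum the equations for `k = 0, 1, 2` with weights `1, 1, 1`, then with weights `1, ω, ω²`: each
  -- sum keeps only the monomials of one character of the rotation group.
  have key : ∀ θ : ℝ, ∀ s t : ℂ, s = Complex.exp (-θ * Complex.I) / 2 →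
      t = Complex.exp (θ * Complex.I) / 2 →
      (h θ : ℂ) ^ 3 + h θ * (s * t) * F - d * (s ^ 3 + t ^ 3) = 0 ∧
      - (h θ : ℂ) ^ 2 * s * A.trace + h θ * t ^ 2 * (Aᴴ).adjugate.trace
        - s ^ 2 * t * (A.adjugate * Aᴴ).trace = 0 := by
    intro θ s t hs ht
    have h0 := hh θ 0
    have h1 := hh θ 1
    have h2 := hh θ 2
    simp only [mul_div_assoc, ← hs, ← ht] at h0 h1 h2
    rw [det_smul_one_sub_pencil, hdet, hBd, ← hF] at h0 h1 h2
    have e1 : ω ^ (2 * 1) = -1 - ω := by linear_combination hω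
    have e2 : ω ^ (2 * 2) = ω := by linear_combination ω * hω3
    have e3 : ω ^ 2 = -1 - ω := by linear_combination hω
    rw [e1] at h1
    rw [e2, e3] at h2
    simp only [mul_zero, pow_zero, one_mul, pow_one] at h0 h1 h2
    generalize (h θ : ℂ) = z at *
    generalize A.trace = τ at *
    generalize (Aᴴ).trace = τ' at *
    generalize A.adjugate.trace = E at *
    generalize (Aᴴ).adjugate.trace = E' at *
    generalize (A.adjugate * Aᴴ).trace = G at *
    generalize ((Aᴴ).adjugate * A).trace = G' at *
    clear_value F
    have hr : ω ^ 2 = -1 - ω := e3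
    have hr3 : ω ^ 3 = 1 := hω3
    have hr4 : ω ^ 4 = ω := by linear_combination ω * hω3
    constructor
    · have := congrArg₂ (· + ·) (congrArg₂ (· + ·) h0 h1) h2
      ring_nf at this
      simp only [hr] at this
      linear_combination (1 / 3) * this
    · have := congrArg₂ (· + ·) (congrArg₂ (· + ·) h0 (congrArg (fun x => ω * x) h1))
        (congrArg (fun x => (-1 - ω) * x) h2)
      ring_nf at this
      simp only [hr3, hr4, hr] at this
      ring_nf at this
      linear_combination (1 / 3) * this
  have hst : ∀ θ : ℝ, Complex.exp (-θ * Complex.I) * Complex.exp (θ * Complex.I) = 1 := by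
    intro θ
    rw [← Complex.exp_add]
    simp
  -- Since `s t = 1/4`, the first relation expresses `cos 3θ` through `h θ`, using `d ≠ 0`; the
  -- cosine takes infinitely many values, hence so does `h`.
  have hinf : (Set.range h).Infinite := by
    intro hfin
    have himg : (Set.range fun θ : ℝ => Real.cos (3 * θ)) ⊆
        (fun x : ℝ => (((4 / d : ℂ) * ((x : ℂ) ^ 3 + x * (1 / 4) * F))).re) '' Set.range h := by
      rintro _ ⟨θ, rfl⟩
      refine ⟨h θ, ⟨θ, rfl⟩, ?_⟩
      obtain ⟨k1, -⟩ := key θ _ _ rfl rfl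
      have hdc : (d : ℂ) ≠ 0 := by exact_mod_cast hd
      have k2 : (4 / d : ℂ) * ((h θ : ℂ) ^ 3 + h θ * (1 / 4) * F) = Complex.cos (3 * θ) := by
        have k3 : ((h θ : ℂ) ^ 3 + h θ * (1 / 4) * F) = d * (Complex.cos (3 * θ) / 4) := by
          have k4 : Complex.cos (3 * θ) = (Complex.exp (θ * Complex.I) ^ 3
              + Complex.exp (-θ * Complex.I) ^ 3) / 2 := by
            rw [Complex.cos, ← Complex.exp_nat_mul, ← Complex.exp_nat_mul]
            push_cast
            ring_nf
          rw [k4]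
          linear_combination k1 - (h θ : ℂ) * F / 4 * hst θ
        rw [k3]
        field_simp
      show ((4 / d : ℂ) * ((h θ : ℂ) ^ 3 + h θ * (1 / 4) * F)).re = _
      rw [k2]
      have : ((Real.cos (3 * θ) : ℝ) : ℂ) = Complex.cos (3 * θ) := by push_cast; rfl
      rw [← this, Complex.ofReal_re]
    have h2 : Set.Icc (-1 : ℝ) 1 ⊆ Set.range fun θ : ℝ => Real.cos (3 * θ) := by
      intro x hx
      exact ⟨Real.arccos x / 3, by
        show Real.cos (3 * (Real.arccos x / 3)) = x
        rw [mul_div_cancel₀ _ (by norm_num : (3 : ℝ) ≠ 0), Real.cos_arccos hx.1 hx.2]⟩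
    exact Set.Icc_infinite (by norm_num : (-1 : ℝ) < 1) ((hfin.image _).subset (h2.trans himg))
  have hcoef : - (A.trace) = 0 ∧ (Aᴴ).adjugate.trace / 2 = 0 ∧
      - (A.adjugate * Aᴴ).trace / 4 = 0 := by
    refine coeff_eq_zero_of_infinite hinf ?_
    rintro _ ⟨θ, rfl⟩
    -- Multiplying the second relation by `2 e^{iθ}` leaves the phase `e^{3iθ}` on the linear term
    -- only.
    refine ⟨Complex.exp (θ * Complex.I) ^ 3, by simp [Complex.norm_exp_ofReal_mul_I], ?_⟩
    obtain ⟨-, k1⟩ := key θ _ _ rfl rfl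
    have k2 := hst θ
    generalize Complex.exp (-θ * Complex.I) = s at *
    generalize Complex.exp (θ * Complex.I) = t at *
    linear_combination 2 * t * k1 + ((h θ : ℂ) ^ 2 * A.trace
      + (A.adjugate * Aᴴ).trace * (s * t + 1) / 4) * k2
  obtain ⟨c1, c2, c3⟩ := hcoef
  refine ⟨by linear_combination -c1, ?_, by linear_combination -4 * c3⟩
  have c4 : (Aᴴ).adjugate.trace = 0 := by linear_combination 2 * c2
  rw [← Matrix.adjugate_conjTranspose, Matrix.trace_conjTranspose] at c4
  simpa using c4

/-! ### An isotropic eigenvector of `Aᴴ A`. -/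

theorem exists_pos_star_dotProduct_self {n : Type*} [Fintype n] {v : n → ℂ} (hv : v ≠ 0) :
    ∃ r : ℝ, 0 < r ∧ star v ⬝ᵥ v = (r : ℂ) ^ 2 := by
  have h1 : star v ⬝ᵥ v = ((∑ i, Complex.normSq (v i) : ℝ) : ℂ) := by
    simp [dotProduct, Complex.normSq_eq_conj_mul_self]
  have h2 : 0 < ∑ i, Complex.normSq (v i) := by
    obtain ⟨i, hi⟩ := Function.ne_iff.1 hv
    exact Finset.sum_pos' (fun j _ => Complex.normSq_nonneg _)
      ⟨i, Finset.mem_univ i, Complex.normSq_pos.2 hi⟩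
  refine ⟨Real.sqrt (∑ i, Complex.normSq (v i)), Real.sqrt_pos.2 h2, ?_⟩
  rw [h1, ← Complex.ofReal_pow, Real.sq_sqrt h2.le]

theorem exists_unit_mulVec_eq_smul {n : Type*} [Fintype n] [DecidableEq n] {A : Matrix n n ℂ}
    {z : ℂ} (h : (A - z • (1 : Matrix n n ℂ)).det = 0) :
    ∃ v : n → ℂ, star v ⬝ᵥ v = 1 ∧ A *ᵥ v = z • v := by
  obtain ⟨v, hv, hA⟩ := Matrix.exists_mulVec_eq_zero_iff.2 h
  rw [Matrix.sub_mulVec, Matrix.smul_mulVec, Matrix.one_mulVec, sub_eq_zero] at hA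
  obtain ⟨r, hr, hr1⟩ := exists_pos_star_dotProduct_self hv
  have hrc : (r : ℂ) ≠ 0 := by exact_mod_cast hr.ne'
  refine ⟨(r : ℂ)⁻¹ • v, ?_, by rw [Matrix.mulVec_smul, hA, smul_comm]⟩
  simp [hr1]
  field_simp

theorem star_mulVec_dotProduct {n : Type*} [Fintype n] (A : Matrix n n ℂ) (x y : n → ℂ) :
    star (A *ᵥ x) ⬝ᵥ y = star x ⬝ᵥ (Aᴴ *ᵥ y) := by
  rw [Matrix.star_mulVec, ← Matrix.dotProduct_mulVec]

theorem star_dotProduct_star {n : Type*} [Fintype n] (x y : n → ℂ) :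
    star (star x ⬝ᵥ y) = star y ⬝ᵥ x := by
  simp [dotProduct, mul_comm]

/-- A multiple of a unitary matrix of order three whose cube is a nonzero scalar has a nonzero
isotropic vector. -/
theorem exists_isotropic_of_conjTranspose_mul_self {A : Matrix (Fin 3) (Fin 3) ℂ} {s d z ω : ℂ}
    (hd : d ≠ 0) (hz : z ^ 3 = d) (hω : 1 + ω + ω ^ 2 = 0)
    (hroot : ∀ y : ℂ, y ^ 3 = d → (A - y • (1 : Matrix (Fin 3) (Fin 3) ℂ)).det = 0)
    (hs : Aᴴ * A = s • (1 : Matrix (Fin 3) (Fin 3) ℂ)) :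
    ∃ v : Fin 3 → ℂ, v ≠ 0 ∧ star v ⬝ᵥ (A *ᵥ v) = 0 := by
  have hω3 : ω ^ 3 = 1 := by linear_combination (ω - 1) * hω
  have hω0 : ω ≠ 0 := by rintro rfl; simp at hω
  have hω1 : ω ≠ 1 := by rintro rfl; norm_num at hω
  have hz0 : z ≠ 0 := by rintro rfl; simp at hz; exact hd hz.symm
  obtain ⟨p, hp, hAp⟩ := exists_unit_mulVec_eq_smul (hroot z hz)
  obtain ⟨q, hq, hAq⟩ := exists_unit_mulVec_eq_smul (hroot (z * ω) (by
    rw [mul_pow, hω3, mul_one, hz]))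
  obtain ⟨r, hr, hAr⟩ := exists_unit_mulVec_eq_smul (hroot (z * ω ^ 2) (by
    rw [mul_pow, ← pow_mul, mul_comm 2 3, pow_mul, hω3, one_pow, mul_one, hz]))
  have hinner : ∀ (x y : Fin 3 → ℂ) (a b : ℂ), A *ᵥ x = a • x → A *ᵥ y = b • y →
      star a * b * (star x ⬝ᵥ y) = s * (star x ⬝ᵥ y) := by
    intro x y a b hx hy
    have h1 := star_mulVec_dotProduct A x (A *ᵥ y)
    rw [Matrix.mulVec_mulVec, hs, Matrix.smul_mulVec, Matrix.one_mulVec, hx, hy, star_smul,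
      smul_dotProduct, dotProduct_smul, dotProduct_smul] at h1
    simpa [mul_assoc] using h1
  have horth : ∀ (x y : Fin 3 → ℂ) (a b : ℂ), A *ᵥ x = a • x → A *ᵥ y = b • y →
      star x ⬝ᵥ x = 1 → a ≠ 0 → a ≠ b → star x ⬝ᵥ y = 0 := by
    intro x y a b hx hy hx1 ha hab
    have h1 := hinner x y a b hx hy
    have h2 := hinner x x a a hx hx
    rw [hx1, mul_one, mul_one] at h2
    have h3 : star a * (a - b) * (star x ⬝ᵥ y) = 0 := by
      linear_combination (star x ⬝ᵥ y) * h2 - h1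
    exact (mul_eq_zero.1 h3).resolve_left (mul_ne_zero (star_ne_zero.2 ha) (sub_ne_zero.2 hab))
  have n1 : z ≠ z * ω := fun h => hω1 (mul_left_cancel₀ hz0 (by rw [← h, mul_one]))
  have n2 : z * ω ≠ z * ω ^ 2 := fun h => n1 (mul_right_cancel₀ hω0 (by linear_combination h))
  have n3 : z * ω ^ 2 ≠ z := fun h => n1 (by linear_combination ω * h - z * hω3)
  have m1 : z * ω ≠ 0 := mul_ne_zero hz0 hω0
  have m2 : z * ω ^ 2 ≠ 0 := mul_ne_zero hz0 (pow_ne_zero 2 hω0)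
  have pq := horth _ _ _ _ hAp hAq hp hz0 n1
  have pr := horth _ _ _ _ hAp hAr hp hz0 n3.symm
  have qp := horth _ _ _ _ hAq hAp hq m1 n1.symm
  have qr := horth _ _ _ _ hAq hAr hq m1 n2
  have rp := horth _ _ _ _ hAr hAp hr m2 n3
  have rq := horth _ _ _ _ hAr hAq hr m2 n2.symm
  -- The eigenvectors are orthonormal, so the form at their sum is the eigenvalue sum `z (1 + ω +
  -- ω²) = 0`.
  refine ⟨p + q + r, ?_, ?_⟩
  · intro h
    have := congrArg (fun x => star p ⬝ᵥ x) h
    simp [dotProduct_add, hp, pq, pr] at this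
  · simp only [Matrix.mulVec_add, hAp, hAq, hAr, star_add, add_dotProduct, dotProduct_add,
      dotProduct_smul, hp, hq, hr, pq, pr, qp, qr, rp, rq, smul_eq_mul]
    linear_combination z * hω

/-- Lagrange elimination in the Vandermonde system: each nonzero `b i` forces `s i` to coincide with
another node. -/
theorem exists_eq_zero_or_all_eq {s b : Fin 3 → ℂ} (h0 : ∑ i, b i = 0) (h1 : ∑ i, s i * b i = 0)
    (h2 : ∑ i, s i ^ 2 * b i = 0) : (∃ i, b i = 0) ∨ ∀ i, s i = s 0 := by
  rw [Fin.sum_univ_three] at h0 h1 h2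
  have e0 : (s 0 - s 1) * (s 0 - s 2) * b 0 = 0 := by
    linear_combination h2 - (s 1 + s 2) * h1 + s 1 * s 2 * h0
  have e1 : (s 1 - s 0) * (s 1 - s 2) * b 1 = 0 := by
    linear_combination h2 - (s 0 + s 2) * h1 + s 0 * s 2 * h0
  have e2 : (s 2 - s 0) * (s 2 - s 1) * b 2 = 0 := by
    linear_combination h2 - (s 0 + s 1) * h1 + s 0 * s 1 * h0
  by_cases c0 : b 0 = 0
  · exact Or.inl ⟨0, c0⟩
  by_cases c1 : b 1 = 0
  · exact Or.inl ⟨1, c1⟩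
  by_cases c2 : b 2 = 0
  · exact Or.inl ⟨2, c2⟩
  right
  simp only [mul_eq_zero, c0, c1, c2, or_false, sub_eq_zero] at e0 e1 e2
  intro i
  fin_cases i <;> simp <;> grind

/-- In an eigenbasis of `Aᴴ A` with eigenvalues `s i`, let `b i` be the diagonal of `(Aᴴ)²`. From
`(Aᴴ)² (Aᴴ A) = d A`, the moments of `b` against `1, s, s²` are `tr (Aᴴ)²`, `d tr A` and `d tr (A Aᴴ
A)`, all zero. A vanishing `b i` makes the `i`-th eigenvector isotropic; otherwise `Aᴴ A` is scalar
and `hiso` applies. -/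
theorem exists_eigenvector_isotropic {A : Matrix (Fin 3) (Fin 3) ℂ} {d : ℝ} (hd : d ≠ 0)
    (hA3 : A ^ 3 = (d : ℂ) • (1 : Matrix (Fin 3) (Fin 3) ℂ)) (htr : A.trace = 0)
    (htr2 : (A ^ 2).trace = 0) (htr21 : (A ^ 2 * Aᴴ).trace = 0)
    (hiso : ∀ s : ℂ, Aᴴ * A = s • (1 : Matrix (Fin 3) (Fin 3) ℂ) →
      ∃ v : Fin 3 → ℂ, v ≠ 0 ∧ star v ⬝ᵥ (A *ᵥ v) = 0) :
    ∃ (v : Fin 3 → ℂ) (s : ℂ), v ≠ 0 ∧ (Aᴴ * A) *ᵥ v = s • v ∧ star v ⬝ᵥ (A *ᵥ v) = 0 := by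
  have hdc : (d : ℂ) ≠ 0 := by exact_mod_cast hd
  obtain ⟨U, hU, s, hs⟩ := (Matrix.isHermitian_conjTranspose_mul_self A).exists_eq_unitary_mul_diagonal
  have hU1 : Uᴴ * U = 1 := Matrix.mem_unitaryGroup_iff'.1 hU
  have hU2 : U * Uᴴ = 1 := Matrix.mem_unitaryGroup_iff.1 hU
  set D := Matrix.diagonal (fun i => (s i : ℂ)) with hD
  have hMU : Aᴴ * A * U = U * D := by rw [hs, mul_assoc, hU1, mul_one]
  set b : Fin 3 → ℂ := fun i => (Uᴴ * (Aᴴ) ^ 2 * U) i i with hb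
  have hH3 : (Aᴴ) ^ 3 = (d : ℂ) • (1 : Matrix (Fin 3) (Fin 3) ℂ) := by
    rw [← Matrix.conjTranspose_pow, hA3, Matrix.conjTranspose_smul]; simp
  have hNM : (Aᴴ) ^ 2 * (Aᴴ * A) = (d : ℂ) • A := by
    rw [← mul_assoc, ← pow_succ, hH3, smul_mul_assoc, one_mul]
  have hsb : ∀ i, (s i : ℂ) * b i = d * (Uᴴ * A * U) i i := by
    intro i
    have h1 : Uᴴ * (Aᴴ) ^ 2 * U * D = (d : ℂ) • (Uᴴ * A * U) := by
      rw [mul_assoc, ← hMU]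
      calc Uᴴ * Aᴴ ^ 2 * (Aᴴ * A * U) = Uᴴ * (Aᴴ ^ 2 * (Aᴴ * A)) * U := by
            simp only [mul_assoc]
        _ = _ := by rw [hNM, mul_smul_comm, smul_mul_assoc]
    have h2 := congrFun (congrFun h1 i) i
    rw [hD, Matrix.mul_diagonal, Matrix.smul_apply, smul_eq_mul] at h2
    rw [← h2, mul_comm]
  have hconj : ∀ X : Matrix (Fin 3) (Fin 3) ℂ, ∑ i, (Uᴴ * X * U) i i = X.trace := by
    intro X
    have : ∑ i, (Uᴴ * X * U) i i = (Uᴴ * X * U).trace := rfl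
    rw [this, mul_assoc, Matrix.trace_mul_comm, mul_assoc, hU2, mul_one]
  have key := exists_eq_zero_or_all_eq (s := fun i => (s i : ℂ)) (b := b) ?_ ?_ ?_
  · obtain ⟨i, hi⟩ | hall := key
    · refine ⟨U *ᵥ Pi.single i 1, s i, ?_, ?_, ?_⟩
      · intro h
        have := congrArg (fun x => Uᴴ *ᵥ x) h
        simp only [Matrix.mulVec_mulVec, hU1, Matrix.one_mulVec, Matrix.mulVec_zero] at this
        simpa using congrFun this i
      · rw [Matrix.mulVec_mulVec, hMU, ← Matrix.mulVec_mulVec, hD, Matrix.diagonal_mulVec_single,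
          ← Matrix.mulVec_smul]
        congr 1
        ext j
        simp [Pi.single_apply]
      · have h1 := hsb i
        rw [hi, mul_zero] at h1
        have h2 : (Uᴴ * A * U) i i = 0 := by simpa [hdc] using h1.symm
        rw [star_mulVec_dotProduct, Matrix.mulVec_mulVec, Matrix.mulVec_mulVec]
        simpa using h2
    · have hscal : Aᴴ * A = (s 0 : ℂ) • (1 : Matrix (Fin 3) (Fin 3) ℂ) := by
        rw [hs, hD]
        have : (fun i => (s i : ℂ)) = fun _ => (s 0 : ℂ) := funext hall
        rw [this, ← Matrix.smul_one_eq_diagonal]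
        simp [hU2]
      obtain ⟨v, hv, hv0⟩ := hiso _ hscal
      exact ⟨v, s 0, hv, by rw [hscal, Matrix.smul_mulVec, Matrix.one_mulVec], hv0⟩
  · rw [hconj, ← Matrix.conjTranspose_pow, Matrix.trace_conjTranspose, htr2, star_zero]
  · simp only [hsb]
    rw [← Finset.mul_sum, hconj, htr, mul_zero]
  · have h1 : ∀ i, (s i : ℂ) ^ 2 * b i = d * (Uᴴ * (A * (Aᴴ * A)) * U) i i := by
      intro i
      have h2 : Uᴴ * (A * (Aᴴ * A)) * U = Uᴴ * A * U * D := by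
        calc Uᴴ * (A * (Aᴴ * A)) * U = Uᴴ * A * (Aᴴ * A * U) := by simp only [mul_assoc]
          _ = _ := by rw [hMU]; simp only [mul_assoc]
      rw [h2, hD, Matrix.mul_diagonal, pow_two, mul_assoc, hsb]
      ring
    simp only [h1]
    rw [← Finset.mul_sum, hconj]
    have : (A * (Aᴴ * A)).trace = (A ^ 2 * Aᴴ).trace := by
      rw [← mul_assoc, Matrix.trace_mul_comm, ← mul_assoc, pow_two]
    rw [this, htr21, mul_zero]

/-! ### The orthogonal cycle and the weighted cyclic form. -/

theorem unitarilySimilar_weightedCyclic_of_orthonormal {A : Matrix (Fin 3) (Fin 3) ℂ}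
    {α₁ α₂ α₃ : ℝ} {e : Fin 3 → Fin 3 → ℂ}
    (he : ∀ i j, star (e i) ⬝ᵥ e j = (1 : Matrix (Fin 3) (Fin 3) ℂ) i j)
    (h0 : A *ᵥ e 0 = (α₃ : ℂ) • e 2) (h1 : A *ᵥ e 1 = (α₁ : ℂ) • e 0)
    (h2 : A *ᵥ e 2 = (α₂ : ℂ) • e 1) :
    UnitarilySimilar A (weightedCyclic α₁ α₂ α₃) := by
  set U : Matrix (Fin 3) (Fin 3) ℂ := (Matrix.of e)ᵀ with hU
  have hU1 : Uᴴ * U = 1 := by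
    ext i j
    exact he i j
  have hU2 : U * Uᴴ = 1 := mul_eq_one_comm.1 hU1
  have hAU : A * U = U * weightedCyclic α₁ α₂ α₃ := by
    ext i j
    have c : ∀ k, (A *ᵥ e k) i = (A * U) i k := fun k => rfl
    fin_cases j
    · simpa [hU, c, Matrix.mul_apply, Fin.sum_univ_three, weightedCyclic, mul_comm]
        using congrFun h0 i
    · simpa [hU, c, Matrix.mul_apply, Fin.sum_univ_three, weightedCyclic, mul_comm]
        using congrFun h1 i
    · simpa [hU, c, Matrix.mul_apply, Fin.sum_univ_three, weightedCyclic, mul_comm]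
        using congrFun h2 i
  exact ⟨U, Matrix.mem_unitaryGroup_iff'.2 hU1, by rw [← hAU, mul_assoc, hU2, mul_one]⟩

theorem exists_unitarilySimilar_weightedCyclic {A : Matrix (Fin 3) (Fin 3) ℂ} {d : ℝ} (hd : 0 < d)
    (hA3 : A ^ 3 = (d : ℂ) • (1 : Matrix (Fin 3) (Fin 3) ℂ)) {v : Fin 3 → ℂ} {s : ℂ} (hv : v ≠ 0)
    (hs : (Aᴴ * A) *ᵥ v = s • v) (hiso : star v ⬝ᵥ (A *ᵥ v) = 0) :
    ∃ α₁ α₂ α₃ : ℝ, 0 < α₁ ∧ 0 < α₂ ∧ 0 < α₃ ∧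
      UnitarilySimilar A (weightedCyclic α₁ α₂ α₃) := by
  have hdc : (d : ℂ) ≠ 0 := by exact_mod_cast hd.ne'
  have hcube : A *ᵥ (A *ᵥ (A *ᵥ v)) = (d : ℂ) • v := by
    rw [Matrix.mulVec_mulVec, Matrix.mulVec_mulVec, ← pow_two, ← pow_succ, hA3, Matrix.smul_mulVec,
      Matrix.one_mulVec]
  have hdv : (d : ℂ) • v ≠ 0 := smul_ne_zero hdc hv
  set w := A *ᵥ v with hw
  set x := A *ᵥ w with hx
  have hx0 : x ≠ 0 := by
    intro h
    rw [h, Matrix.mulVec_zero] at hcube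
    exact hdv hcube.symm
  have hw0 : w ≠ 0 := by
    intro h
    rw [h, Matrix.mulVec_zero] at hx
    exact hx0 hx
  have hs' : Aᴴ *ᵥ w = s • v := by rw [hw, Matrix.mulVec_mulVec, hs]
  have hs0 : s ≠ 0 := by
    rintro rfl
    rw [zero_smul] at hs'
    have h1 := star_mulVec_dotProduct A v w
    rw [hs', dotProduct_zero, ← hw] at h1
    obtain ⟨r, hr, hr1⟩ := exists_pos_star_dotProduct_self hw0
    rw [hr1] at h1
    exact hr.ne' (by exact_mod_cast pow_eq_zero_iff two_ne_zero |>.1 h1)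
  have hvw : star v ⬝ᵥ w = 0 := hiso
  have hwv : star w ⬝ᵥ v = 0 := by rw [← star_dotProduct_star, hvw, star_zero]
  have hxw : star x ⬝ᵥ w = 0 := by
    rw [hx, star_mulVec_dotProduct, hs', dotProduct_smul, hwv, smul_zero]
  have hwx : star w ⬝ᵥ x = 0 := by rw [← star_dotProduct_star, hxw, star_zero]
  -- Here `A³ = d` closes the cycle: `s ⟨x, v⟩ = ⟨x, Aᴴ w⟩ = ⟨A x, w⟩ = d ⟨v, w⟩ = 0`.
  have hxv : star x ⬝ᵥ v = 0 := by
    have h1 := star_mulVec_dotProduct A x w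
    rw [hcube, hs', dotProduct_smul, star_smul, smul_dotProduct, hvw, smul_zero, smul_eq_mul] at h1
    exact (mul_eq_zero.1 h1.symm).resolve_left hs0
  have hvx : star v ⬝ᵥ x = 0 := by rw [← star_dotProduct_star, hxv, star_zero]
  obtain ⟨a, ha, hva⟩ := exists_pos_star_dotProduct_self hv
  obtain ⟨b, hb, hwb⟩ := exists_pos_star_dotProduct_self hw0
  obtain ⟨c, hc, hxc⟩ := exists_pos_star_dotProduct_self hx0
  have ha' : (a : ℂ) ≠ 0 := by exact_mod_cast ha.ne'
  have hb' : (b : ℂ) ≠ 0 := by exact_mod_cast hb.ne'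
  have hc' : (c : ℂ) ≠ 0 := by exact_mod_cast hc.ne'
  -- The target matrix sends `e 0 → e 2 → e 1 → e 0`, so the orbit `v, w, x` is listed as `v, x, w`;
  -- the weights are ratios of norms.
  refine ⟨d * a / c, c / b, b / a, by positivity, by positivity, by positivity,
    unitarilySimilar_weightedCyclic_of_orthonormal
      (e := ![(a : ℂ)⁻¹ • v, (c : ℂ)⁻¹ • x, (b : ℂ)⁻¹ • w]) ?_ ?_ ?_ ?_⟩
  · intro i j
    fin_cases i <;> fin_cases j <;>
      simp [hvw, hwv, hxw, hwx, hxv, hvx, hva, hwb, hxc] <;> field_simp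
  · simp only [Matrix.cons_val, Matrix.mulVec_smul, ← hw, smul_smul]
    congr 1
    push_cast
    field_simp
  · simp only [Matrix.cons_val, Matrix.mulVec_smul, hcube, smul_smul]
    congr 1
    push_cast
    field_simp
  · simp only [Matrix.cons_val, Matrix.mulVec_smul, ← hx, smul_smul]
    congr 1
    push_cast
    field_simp

/-! ### The support function and the equivalence. -/

theorem exists_ray_eigenvalue (A : Matrix (Fin 3) (Fin 3) ℂ) (c : ℂ) :
    ∃ μ : ℝ, IsGreatest ((fun z => (c * z).re) '' numericalRange A) μ ∧
      ((μ : ℂ) • (1 : Matrix (Fin 3) (Fin 3) ℂ) - ((c / 2) • A + (star c / 2) • Aᴴ)).det = 0 := by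
  have hH : ((c / 2) • A + (star c / 2) • Aᴴ).IsHermitian := by
    rw [Matrix.IsHermitian, Matrix.conjTranspose_add, Matrix.conjTranspose_smul,
      Matrix.conjTranspose_smul, Matrix.conjTranspose_conjTranspose, add_comm]
    simp
  obtain ⟨μ, hμ, hdet⟩ := hH.exists_isGreatest
  refine ⟨μ, ?_, hdet⟩
  convert hμ using 1
  have hre : ∀ x : Fin 3 → ℂ, (star x ⬝ᵥ (((c / 2) • A + (star c / 2) • Aᴴ) *ᵥ x)).re
      = (c * (star x ⬝ᵥ (A *ᵥ x))).re := by
    intro x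
    have h1 : star x ⬝ᵥ (Aᴴ *ᵥ x) = star (star x ⬝ᵥ (A *ᵥ x)) := by
      rw [← star_mulVec_dotProduct, star_dotProduct_star]
    rw [Matrix.add_mulVec, Matrix.smul_mulVec, Matrix.smul_mulVec, dotProduct_add, dotProduct_smul,
      dotProduct_smul, h1]
    simp
    ring
  ext r
  constructor
  · rintro ⟨_, ⟨x, hx, rfl⟩, rfl⟩
    exact ⟨x, hx, (hre x).symm⟩
  · rintro ⟨x, hx, rfl⟩
    exact ⟨_, ⟨x, hx, rfl⟩, (hre x).symm⟩

theorem mainTheorem3 (A : Matrix (Fin 3) (Fin 3) ℂ)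
    (hdet_im : A.det.im = 0) (hdet_pos : 0 < A.det.re) :
    IsRotationInvariant (2 * Real.pi / 3) (numericalRange A) ↔
      ∃ θ α₁ α₂ α₃ : ℝ, 0 < α₁ ∧ 0 < α₂ ∧ 0 < α₃ ∧
        UnitarilySimilar A
          (Complex.exp (θ * Complex.I) • weightedCyclic α₁ α₂ α₃) := by
  set ω := Complex.exp ((2 * Real.pi / 3 : ℝ) * Complex.I) with hω
  have hω3 : ω ^ 3 = 1 := by
    rw [hω, ← Complex.exp_nat_mul, ← Complex.exp_two_pi_mul_I]
    congr 1
    push_cast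
    ring
  have hω1 : ω ≠ 1 := by
    have h := (Complex.isPrimitiveRoot_exp 3 (by norm_num)).ne_one (by norm_num)
    rw [hω]
    convert h using 2
    push_cast
    ring
  have hωsum : 1 + ω + ω ^ 2 = 0 :=
    (mul_eq_zero.1 (by linear_combination hω3 : (ω - 1) * (1 + ω + ω ^ 2) = 0)).resolve_left
      (sub_ne_zero.2 hω1)
  have hωs : star ω * ω = 1 := by
    rw [Complex.star_def, Complex.conj_mul', hω, Complex.norm_exp_ofReal_mul_I]
    simp
  have hrot : IsRotationInvariant (2 * Real.pi / 3) (numericalRange A) ↔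
      (fun z => ω * z) '' numericalRange A = numericalRange A := Iff.rfl
  rw [hrot]
  constructor
  · intro hinv
    set d := A.det.re with hd
    have hdet : A.det = (d : ℂ) := Complex.ext (by simp [hd]) (by simp [hdet_im])
    choose h hmax hroot using fun θ : ℝ => exists_ray_eigenvalue A (Complex.exp (-θ * Complex.I))
    have hpow : ∀ k : ℕ, (fun z => ω ^ k * z) '' numericalRange A = numericalRange A := by
      intro k
      induction k with
      | zero => simp
      | succ k ih =>
        conv_rhs => rw [← hinv, ← ih, Set.image_image]
        simp only [pow_succ', mul_assoc]
    have hconj : star ω = ω ^ 2 := by linear_combination ω ^ 2 * hωs - star ω * hω3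
    have hexp : ∀ θ : ℝ, star (Complex.exp (-θ * Complex.I)) = Complex.exp (θ * Complex.I) := by
      intro θ
      rw [Complex.star_def, ← Complex.exp_conj]
      simp
    have hh : ∀ θ : ℝ, ∀ k : ℕ, ((h θ : ℂ) • (1 : Matrix (Fin 3) (Fin 3) ℂ)
        - (((ω ^ (2 * k) * Complex.exp (-θ * Complex.I) / 2) • A
          + (ω ^ k * Complex.exp (θ * Complex.I) / 2) • Aᴴ))).det = 0 := by
      intro θ k
      -- Rotating the direction by `ω^(2k)` leaves the maximum unchanged, so `μ = h θ`; conjugation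
      -- turns `ω^(2k)` into `ω^k`.
      obtain ⟨μ, hμ, hμdet⟩ :=
        exists_ray_eigenvalue A (ω ^ (2 * k) * Complex.exp (-θ * Complex.I))
      have himg : (fun z => (ω ^ (2 * k) * Complex.exp (-θ * Complex.I) * z).re) '' numericalRange A
          = (fun z => (Complex.exp (-θ * Complex.I) * z).re) '' numericalRange A := by
        conv_rhs => rw [← hpow (2 * k), Set.image_image]
        refine Set.image_congr fun z _ => ?_
        congr 1
        ring
      rw [himg] at hμ
      rw [hμ.unique (hmax θ)] at hμdet
      have hst : star (ω ^ (2 * k) * Complex.exp (-θ * Complex.I))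
          = ω ^ k * Complex.exp (θ * Complex.I) := by
        rw [star_mul', hexp, star_pow, hconj, ← pow_mul]
        have : ω ^ (2 * (2 * k)) = ω ^ k := by
          rw [show 2 * (2 * k) = 3 * k + k by ring, pow_add, pow_mul, hω3, one_pow, one_mul]
        rw [this]
      rw [hst] at hμdet
      exact hμdet
    obtain ⟨htr, hE, hG⟩ := det_trace_conditions A d hdet_pos.ne' hdet ω hωsum h hh
    have hadj : A.adjugate = A ^ 2 := by
      rw [adjugate_eq_of_fin_three, htr, hE]
      simp
    rw [hadj] at hE hG
    have hA3 : A ^ 3 = (d : ℂ) • (1 : Matrix (Fin 3) (Fin 3) ℂ) := by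
      rw [← hdet, ← Matrix.mul_adjugate, hadj, pow_succ']
    have hz : (((d ^ (1 / 3 : ℝ) : ℝ)) : ℂ) ^ 3 = d := by
      rw [← Complex.ofReal_pow, ← Real.rpow_natCast, ← Real.rpow_mul hdet_pos.le]
      norm_num
    have hroots : ∀ y : ℂ, y ^ 3 = d → (A - y • (1 : Matrix (Fin 3) (Fin 3) ℂ)).det = 0 := by
      intro y hy
      have h1 := det_smul_one_sub_pencil A 0 y 1 0
      rw [htr, hadj, hE, hdet] at h1
      rw [← neg_sub, Matrix.det_neg]
      simp [hy] at h1
      simp [h1]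
    obtain ⟨v, s, hv, hs, hiso⟩ := exists_eigenvector_isotropic hdet_pos.ne' hA3 htr hE hG
      fun s hs => exists_isotropic_of_conjTranspose_mul_self
        (by exact_mod_cast hdet_pos.ne') hz hωsum hroots hs
    obtain ⟨α₁, α₂, α₃, h₁, h₂, h₃, hsim⟩ :=
      exists_unitarilySimilar_weightedCyclic hdet_pos hA3 hv hs hiso
    -- The positive determinant allows `θ = 0`.
    exact ⟨0, α₁, α₂, α₃, h₁, h₂, h₃, by simpa using hsim⟩
  · rintro ⟨θ, α₁, α₂, α₃, -, -, -, hsim⟩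
    rw [hsim.numericalRange_eq, ← numericalRange_smul,
      (unitarilySimilar_smul_weightedCyclic _ ω hω3 hωs α₁ α₂ α₃).numericalRange_eq]
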